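/- Let $s_1,s_2,s_3$ be the Pauli matrices. A two-qubit state $\sigma$ (a positive semidefinite operator of trace one on $\mathbb{C}^2\otimes\mathbb{C}^2$) is called Bell-CHSH local if $$\bigl|\operatorname{Tr}\bigl[\sigma\bigl(A_0\otimes(B_0+B_1)+A_1\otimes(B_0-B_1)\bigr)\bigr]\bigr|\le 2$$ for all one-qubit observables $A_0,A_1,B_0,B_1$ with outcomes $\pm1$ (Hermitian $2\times2$ matrices whose square is the identity), and absolutely Bell-CHSH local if $U\sigma U^\dagger$ is Bell-CHSH local for every unitary $U$ on $\mathbb{C}^2\otimes\mathbb{C}^2$. The correlation matrix of $\sigma$ is $T=[t_{ij}]_{i,j=1}^{3}$ with $t_{ij}=\operatorname{Tr}[\sigma(s_i\otimes s_j)]$. The state $\sigma$ is Bell-diagonal if it is of the form $\sigma=\sum_{k=1}^4 a_k|\phi_k\rangle\langle\phi_k|$ with real $a_k$, where $\phi_1,\dots,\phi_4$ are the Bell states $(|00\rangle\pm|11\rangle)/\sqrt2$, $(|01\rangle\pm|10\rangle)/\sqrt2$. Theorem. Let $\sigma$ be a Bell-diagonal state with correlation matrix $T$. Then $T$ is diagonal,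 and $\sigma$ is absolutely Bell-CHSH local if and only if $$\max\bigl(t_{11}^2+t_{22}^2,\; t_{11}^2+t_{33}^2,\; t_{22}^2+t_{33}^2\bigr)\le 1 .$$ Moreover, $\sigma$ is absolutely Bell-CHSH local if and only if it is Bell-CHSH local. -/

import Mathlib

open scoped ComplexOrder Kronecker Matrix

namespace BellCHSH

/-- Basis index of the two-qubit space `ℂ² ⊗ ℂ²`: the pair `(a, b)` labels `|a b⟩`. -/
abbrev Idx : Type := Fin 2 × Fin 2

/-- Operators on `ℂ² ⊗ ℂ²`. -/
abbrev Op : Type := Matrix Idx Idx ℂ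

/-- Two-qubit states: positive semidefinite operators of trace one. -/
structure IsState (σ : Op) : Prop where
  posSemidef : σ.PosSemidef
  trace_eq_one : σ.trace = 1

/-- The Pauli matrices `s₁, s₂, s₃` (indexed from `0`). -/
def pauli : Fin 3 → Matrix (Fin 2) (Fin 2) ℂ :=
  ![!![0, 1; 1, 0], !![0, -Complex.I; Complex.I, 0], !![1, 0; 0, -1]]

/-- The expectation value `Tr(σ O)`; it is a real number when `σ` and `O` are Hermitian. -/
def expectation (σ O : Op) : ℝ := (σ * O).trace.re

/-- The correlation matrix `T = [t_ij]`, `t_ij = Tr(σ (s_i ⊗ s_j))`. -/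
def correlationMatrix (σ : Op) : Matrix (Fin 3) (Fin 3) ℝ :=
  Matrix.of fun i j => expectation σ (pauli i ⊗ₖ pauli j)

/-- One-qubit observables with outcomes `±1`: Hermitian matrices squaring to the identity. -/
structure IsDichotomic (A : Matrix (Fin 2) (Fin 2) ℂ) : Prop where
  isHermitian : A.IsHermitian
  sq_eq_one : A * A = 1

/-- The Bell-CHSH operator `A₀ ⊗ (B₀ + B₁) + A₁ ⊗ (B₀ - B₁)`. -/
def chshOperator (A₀ A₁ B₀ B₁ : Matrix (Fin 2) (Fin 2) ℂ) : Op :=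
  A₀ ⊗ₖ (B₀ + B₁) + A₁ ⊗ₖ (B₀ - B₁)

/-- `σ` is Bell-CHSH local: no choice of local `±1`-valued observables violates the Bell-CHSH
inequality. -/
def IsLocal (σ : Op) : Prop :=
  ∀ A₀ A₁ B₀ B₁ : Matrix (Fin 2) (Fin 2) ℂ,
    IsDichotomic A₀ → IsDichotomic A₁ → IsDichotomic B₀ → IsDichotomic B₁ →
      |expectation σ (chshOperator A₀ A₁ B₀ B₁)| ≤ 2

/-- `σ` is absolutely Bell-CHSH local: `U σ U†` is Bell-CHSH local for every global unitary. -/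
def IsAbsolutelyLocal (σ : Op) : Prop :=
  ∀ U ∈ Matrix.unitaryGroup Idx ℂ, IsLocal (U * σ * Uᴴ)

/-- The computational basis vector `|a b⟩`. -/
def ket (a b : Fin 2) : Idx → ℂ := Pi.single (a, b) 1

/-- The four Bell states `(|00⟩ ± |11⟩)/√2` and `(|01⟩ ± |10⟩)/√2`. -/
noncomputable def bellState : Fin 4 → Idx → ℂ :=
  ![((√2 : ℝ) : ℂ)⁻¹ • (ket 0 0 + ket 1 1), ((√2 : ℝ) : ℂ)⁻¹ • (ket 0 0 - ket 1 1),
    ((√2 : ℝ) : ℂ)⁻¹ • (ket 0 1 + ket 1 0), ((√2 : ℝ) : ℂ)⁻¹ • (ket 0 1 - ket 1 0)]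

/-- `σ` is diagonal in the Bell basis: `σ = ∑ a_k |φ_k⟩⟨φ_k|` with real coefficients. -/
def IsBellDiagonal (σ : Op) : Prop :=
  ∃ a : Fin 4 → ℝ,
    σ = ∑ k, (a k : ℂ) • Matrix.vecMulVec (bellState k) (star (bellState k))

end BellCHSH

namespace BellCHSH

/-! Necessity is seen by measuring along two Pauli axes with the best `B₀`, `B₁`, where the CHSH
value is `2√(tᵢᵢ² + tⱼⱼ²)`. For sufficiency, only the eigenvalues `a` survive a global unitary, and
the three bounds on `T` are bounds on the pairings of `a`. Let `B` be a CHSH operator. If `A₀`, `A₁`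
commute, then `B² = 4` and no state exceeds `2`. Otherwise some `N` anticommutes with both
(`exists_anticommuting`), so `W = N ⊗ 1` satisfies `WBW = -B` and `2 Tr(ρB) = Tr((ρ - WρW)B)`. As
`‖B‖ = 4` in Hilbert–Schmidt norm, it suffices that `‖ρ - WρW‖ ≤ 1`. In an eigenbasis this squared
norm is `∑ (aᵢ - aⱼ)² |Wᵢⱼ|²`, linear in a doubly stochastic matrix, so Birkhoff's theorem reduces
it to permutations (`sum_sub_perm_sq_le`). -/

/-- Used twice: the square is `4` when `A₀`, `A₁` commute, and its trace is always `16` because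
commutators are traceless. -/
theorem chshOperator_mul_self {A₀ A₁ B₀ B₁ : Matrix (Fin 2) (Fin 2) ℂ}
    (hA₀ : A₀ * A₀ = 1) (hA₁ : A₁ * A₁ = 1) (hB₀ : B₀ * B₀ = 1) (hB₁ : B₁ * B₁ = 1) :
    chshOperator A₀ A₁ B₀ B₁ * chshOperator A₀ A₁ B₀ B₁ =
      (4 : ℂ) • 1 - (A₀ * A₁ - A₁ * A₀) ⊗ₖ (B₀ * B₁ - B₁ * B₀) := by
  have h (X Y : Matrix (Fin 2) (Fin 2) ℂ) : X ⊗ₖ (-Y) = -(X ⊗ₖ Y) := by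
    ext; simp [Matrix.kroneckerMap_apply]
  have h' (X Y : Matrix (Fin 2) (Fin 2) ℂ) : (-X) ⊗ₖ Y = -(X ⊗ₖ Y) := by
    ext; simp [Matrix.kroneckerMap_apply]
  simp only [chshOperator, add_mul, mul_add, ← Matrix.mul_kronecker_mul,
    hA₀, hA₁, hB₀, hB₁, sub_eq_add_neg, Matrix.kronecker_add, Matrix.add_kronecker, h, h',
    neg_add, neg_neg, Matrix.one_kronecker_one, mul_neg, neg_mul]
  module

theorem chshOperator_isHermitian {A₀ A₁ B₀ B₁ : Matrix (Fin 2) (Fin 2) ℂ}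
    (hA₀ : A₀.IsHermitian) (hA₁ : A₁.IsHermitian) (hB₀ : B₀.IsHermitian) (hB₁ : B₁.IsHermitian) :
    (chshOperator A₀ A₁ B₀ B₁).IsHermitian := by
  simp only [Matrix.IsHermitian] at *
  simp only [chshOperator, Matrix.conjTranspose_add, Matrix.conjTranspose_kronecker,
    Matrix.conjTranspose_sub, hA₀, hA₁, hB₀, hB₁]

theorem trace_mul_self_nonneg {n : Type*} [Fintype n] [DecidableEq n] {X : Matrix n n ℂ}
    (hX : X.IsHermitian) : 0 ≤ (X * X).trace.re := by
  have h := (Matrix.posSemidef_conjTranspose_mul_self X).trace_nonneg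
  rw [hX.eq] at h
  exact (Complex.le_def.mp h).1

/-- A Hermitian operator squaring to `4` has expectation at most `2` in every state. -/
theorem IsState.expectation_le_two {ρ : Op} (hρ : IsState ρ) {B : Op} (hB : B.IsHermitian)
    (hB2 : B * B = (4 : ℂ) • 1) : expectation ρ B ≤ 2 := by
  have hX : ((2 : ℂ) • 1 - B : Op)ᴴ = (2 : ℂ) • 1 - B := by
    simp [Matrix.conjTranspose_sub, Matrix.conjTranspose_smul, hB.eq]
  have h := (hρ.posSemidef.mul_mul_conjTranspose_same ((2 : ℂ) • 1 - B : Op)).trace_nonneg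
  rw [hX, Matrix.trace_mul_cycle, Matrix.trace_mul_comm] at h
  have e : ((2 : ℂ) • 1 - B : Op) * ((2 : ℂ) • 1 - B) = (8 : ℂ) • 1 - (4 : ℂ) • B := by
    simp only [sub_mul, mul_sub, hB2, smul_mul_assoc, mul_smul_comm, one_mul, mul_one]
    module
  rw [e, mul_sub, Matrix.trace_sub, mul_smul_comm, mul_smul_comm, mul_one, Matrix.trace_smul,
    Matrix.trace_smul, hρ.trace_eq_one] at h
  have h1 := (Complex.le_def.mp h).1
  simp only [smul_eq_mul, Complex.sub_re, Complex.mul_re, Complex.zero_re, Complex.re_ofNat,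
    Complex.im_ofNat, Complex.one_re, Complex.one_im] at h1
  rw [expectation]
  linarith

theorem expectation_neg (ρ B : Op) : expectation ρ (-B) = -expectation ρ B := by
  simp [expectation]

theorem IsState.abs_expectation_le_two {ρ : Op} (hρ : IsState ρ) {B : Op} (hB : B.IsHermitian)
    (hB2 : B * B = (4 : ℂ) • 1) : |expectation ρ B| ≤ 2 := by
  have h := hρ.expectation_le_two hB.neg (by rw [neg_mul_neg, hB2])
  rw [expectation_neg] at h
  exact abs_le.mpr ⟨by linarith, hρ.expectation_le_two hB hB2⟩

theorem IsState.unitary_conj {σ U : Op} (hσ : IsState σ) (hU : U ∈ Matrix.unitaryGroup Idx ℂ) :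
    IsState (U * σ * Uᴴ) where
  posSemidef := hσ.posSemidef.mul_mul_conjTranspose_same U
  trace_eq_one := by
    have h : Uᴴ * U = 1 := Matrix.mem_unitaryGroup_iff'.mp hU
    rw [Matrix.trace_mul_cycle, h, one_mul, hσ.trace_eq_one]

/-! ### Eigenvalue inequalities and Birkhoff's theorem -/

/-- The three pairings of four numbers control all permutations of them. -/
theorem sum_sub_perm_sq_le {a : Fin 4 → ℝ}
    (h₁ : 2 * ((a 0 - a 1) ^ 2 + (a 2 - a 3) ^ 2) ≤ 1)
    (h₂ : 2 * ((a 0 - a 2) ^ 2 + (a 1 - a 3) ^ 2) ≤ 1)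
    (h₃ : 2 * ((a 0 - a 3) ^ 2 + (a 1 - a 2) ^ 2) ≤ 1) (π : Equiv.Perm (Fin 4)) :
    ∑ i, (a i - a (π i)) ^ 2 ≤ 1 := by
  -- Handles 3-cycles: the two smaller gaps add up to the largest, so their squares sum to at most
  -- its square.
  have cyc (x y z : ℝ) (hxy : 2 * (x - y) ^ 2 ≤ 1) (hyz : 2 * (y - z) ^ 2 ≤ 1)
      (hxz : 2 * (x - z) ^ 2 ≤ 1) : (x - y) ^ 2 + (y - z) ^ 2 + (x - z) ^ 2 ≤ 1 := by
    rcases le_total x y with h | h <;> rcases le_total y z with h' | h' <;>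
      rcases le_total x z with h'' | h'' <;>
      nlinarith [mul_nonneg (sub_nonneg.mpr h) (sub_nonneg.mpr h'),
        mul_nonneg (sub_nonneg.mpr h) (sub_nonneg.mpr h''),
        mul_nonneg (sub_nonneg.mpr h') (sub_nonneg.mpr h'')]
  have s01 := sq_nonneg (a 0 - a 1)
  have s02 := sq_nonneg (a 0 - a 2)
  have s03 := sq_nonneg (a 0 - a 3)
  have s12 := sq_nonneg (a 1 - a 2)
  have s13 := sq_nonneg (a 1 - a 3)
  have s23 := sq_nonneg (a 2 - a 3)
  have c012 := cyc (a 0) (a 1) (a 2) (by linarith) (by linarith) (by linarith)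
  have c013 := cyc (a 0) (a 1) (a 3) (by linarith) (by linarith) (by linarith)
  have c023 := cyc (a 0) (a 2) (a 3) (by linarith) (by linarith) (by linarith)
  have c123 := cyc (a 1) (a 2) (a 3) (by linarith) (by linarith) (by linarith)
  have i01 : π 0 ≠ π 1 := by simp
  have i02 : π 0 ≠ π 2 := by simp
  have i03 : π 0 ≠ π 3 := by simp
  have i12 : π 1 ≠ π 2 := by simp
  have i13 : π 1 ≠ π 3 := by simp
  have i23 : π 2 ≠ π 3 := by simp
  rw [Fin.sum_univ_four]
  generalize π 0 = p at *
  generalize π 1 = q at *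
  generalize π 2 = r at *
  generalize π 3 = s at *
  clear cyc
  fin_cases p <;> fin_cases q <;> first | exact absurd rfl i01 | skip
  all_goals fin_cases r <;> first | exact absurd rfl i02 | exact absurd rfl i12 | skip
  all_goals fin_cases s <;> first
    | exact absurd rfl i03 | exact absurd rfl i13 | exact absurd rfl i23 | skip
  all_goals
    simp only [Fin.zero_eta, Fin.mk_one, Fin.reduceFinMk]
    linarith

/-- The left side is linear in `S`, and doubly stochastic matrices are the convex hull of
permutation matrices. -/
theorem sum_sub_sq_mul_le {a : Fin 4 → ℝ}
    (h₁ : 2 * ((a 0 - a 1) ^ 2 + (a 2 - a 3) ^ 2) ≤ 1)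
    (h₂ : 2 * ((a 0 - a 2) ^ 2 + (a 1 - a 3) ^ 2) ≤ 1)
    (h₃ : 2 * ((a 0 - a 3) ^ 2 + (a 1 - a 2) ^ 2) ≤ 1)
    {S : Matrix (Fin 4) (Fin 4) ℝ} (hS : S ∈ doublyStochastic ℝ (Fin 4)) :
    ∑ i, ∑ j, (a i - a j) ^ 2 * S i j ≤ 1 := by
  let f : Matrix (Fin 4) (Fin 4) ℝ →ₗ[ℝ] ℝ :=
    { toFun := fun S => ∑ i, ∑ j, (a i - a j) ^ 2 * S i j
      map_add' := by intro X Y; simp [mul_add, Finset.sum_add_distrib]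
      map_smul' := by intro c X; simp [Finset.mul_sum, mul_left_comm] }
  have hsub : {M : Matrix (Fin 4) (Fin 4) ℝ | ∃ π : Equiv.Perm (Fin 4), π.permMatrix ℝ = M} ⊆
      {M | f M ≤ 1} := by
    rintro M ⟨π, rfl⟩
    have : f (π.permMatrix ℝ) = ∑ i, (a i - a (π i)) ^ 2 := by
      simp [f, Equiv.Perm.permMatrix, PEquiv.toMatrix_apply]
    exact this.trans_le <| sum_sub_perm_sq_le h₁ h₂ h₃ π
  have hconv : Convex ℝ {M | f M ≤ 1} := convex_halfSpace_le f.isLinear 1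
  have hmem : S ∈ (doublyStochastic ℝ (Fin 4) : Set (Matrix (Fin 4) (Fin 4) ℝ)) := hS
  rw [doublyStochastic_eq_convexHull_permMatrix] at hmem
  exact convexHull_min hsub hconv hmem


/-! ### Sign-flipping symmetries and the sufficiency bound -/

/-- Cayley–Hamilton with zero trace gives `C² = -det C`; skew-Hermiticity makes the determinant a
sum of squared moduli. -/
theorem mul_self_eq_of_skewHermitian {C : Matrix (Fin 2) (Fin 2) ℂ} (hC : Cᴴ = -C)
    (htr : C.trace = 0) :
    C * C = (-((Complex.normSq (C 0 0) + Complex.normSq (C 0 1) : ℝ) : ℂ)) • 1 := by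
  have h00 : star (C 0 0) = -C 0 0 := congrFun (congrFun hC 0) 0
  have h01 : star (C 0 1) = -C 1 0 := congrFun (congrFun hC 1) 0
  have h11 : C 1 1 = -C 0 0 := by
    rw [Matrix.trace_fin_two] at htr
    linear_combination htr
  have h10 : C 1 0 = -star (C 0 1) := by rw [h01, neg_neg]
  have n0 : ((Complex.normSq (C 0 0) : ℝ) : ℂ) = -(C 0 0 * C 0 0) := by
    rw [← Complex.mul_conj, starRingEnd_apply, h00, mul_neg]
  have n1 : ((Complex.normSq (C 0 1) : ℝ) : ℂ) = -(C 0 1 * C 1 0) := by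
    rw [← Complex.mul_conj, starRingEnd_apply, h01, mul_neg]
  ext i j
  fin_cases i <;> fin_cases j <;>
    simp [Matrix.mul_apply, Fin.sum_univ_two, n0, n1, h11] <;> ring

/-- Two noncommuting qubit observables anticommute with a common observable. -/
theorem exists_anticommuting {A₀ A₁ : Matrix (Fin 2) (Fin 2) ℂ} (hA₀ : IsDichotomic A₀)
    (hA₁ : IsDichotomic A₁) (hne : A₀ * A₁ - A₁ * A₀ ≠ 0) :
    ∃ N : Matrix (Fin 2) (Fin 2) ℂ, IsDichotomic N ∧ N * A₀ = -(A₀ * N) ∧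
      N * A₁ = -(A₁ * N) := by
  set C := A₀ * A₁ - A₁ * A₀ with hCdef
  have hC : Cᴴ = -C := by
    rw [hCdef, Matrix.conjTranspose_sub, Matrix.conjTranspose_mul, Matrix.conjTranspose_mul,
      hA₀.isHermitian.eq, hA₁.isHermitian.eq, neg_sub]
  have htr : C.trace = 0 := by rw [hCdef, Matrix.trace_sub, Matrix.trace_mul_comm, sub_self]
  have hsq := mul_self_eq_of_skewHermitian hC htr
  set d := Complex.normSq (C 0 0) + Complex.normSq (C 0 1) with hd
  have hdpos : 0 < d := by
    refine lt_of_le_of_ne (add_nonneg (Complex.normSq_nonneg _) (Complex.normSq_nonneg _)) ?_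
    intro h0
    rw [← h0] at hsq
    have : Cᴴ * C = 0 := by rw [hC, neg_mul, hsq]; simp
    exact hne (Matrix.conjTranspose_mul_self_eq_zero.mp this)
  have hd2 : (((√d)⁻¹ : ℝ) : ℂ) * (((√d)⁻¹ : ℝ) : ℂ) * (d : ℂ) = 1 := by
    rw [← Complex.ofReal_mul, ← Complex.ofReal_mul, ← mul_inv, Real.mul_self_sqrt hdpos.le,
      inv_mul_cancel₀ hdpos.ne', Complex.ofReal_one]
  have h0 : C * A₀ = -(A₀ * C) := by
    rw [hCdef, sub_mul, mul_sub, mul_assoc A₁, hA₀.sq_eq_one, ← mul_assoc A₀ A₀, hA₀.sq_eq_one,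
      mul_assoc]
    simp
  have h1 : C * A₁ = -(A₁ * C) := by
    rw [hCdef, sub_mul, mul_sub, mul_assoc A₀, hA₁.sq_eq_one, ← mul_assoc A₁ A₁, hA₁.sq_eq_one,
      mul_assoc]
    simp
  -- The commutator `C` itself anticommutes with both; the factor `i` makes it Hermitian and `1/√d`
  -- normalises `C² = -d`.
  refine ⟨(Complex.I * (((√d)⁻¹ : ℝ) : ℂ)) • C, ⟨?_, ?_⟩, ?_, ?_⟩
  · rw [Matrix.IsHermitian, Matrix.conjTranspose_smul, hC]
    simp
  · rw [smul_mul_smul_comm, hsq, smul_smul]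
    have : Complex.I * (((√d)⁻¹ : ℝ) : ℂ) * (Complex.I * (((√d)⁻¹ : ℝ) : ℂ)) * -(d : ℂ) = 1 := by
      linear_combination hd2 - (((√d)⁻¹ : ℝ) : ℂ) * (((√d)⁻¹ : ℝ) : ℂ) * (d : ℂ) * Complex.I_sq
    rw [this, one_smul]
  · rw [smul_mul_assoc, h0, mul_smul_comm, smul_neg]
  · rw [smul_mul_assoc, h1, mul_smul_comm, smul_neg]

theorem normSq_mem_doublyStochastic {n : Type*} [Fintype n] [DecidableEq n] {W : Matrix n n ℂ}
    (hW : W * Wᴴ = 1) : W.map Complex.normSq ∈ doublyStochastic ℝ n := by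
  have key {X : Matrix n n ℂ} (hX : X * Xᴴ = 1) (i : n) : ∑ j, Complex.normSq (X i j) = 1 := by
    have h := congrFun (congrFun hX i) i
    rw [Matrix.mul_apply, Matrix.one_apply_eq] at h
    apply Complex.ofReal_injective
    rw [Complex.ofReal_sum, Complex.ofReal_one, ← h]
    refine Finset.sum_congr rfl fun j _ => ?_
    rw [Matrix.conjTranspose_apply, ← Complex.mul_conj, starRingEnd_apply]
  have hW' : Wᴴ * Wᴴᴴ = 1 := by
    rw [Matrix.conjTranspose_conjTranspose]
    exact mul_eq_one_comm.mp hW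
  refine mem_doublyStochastic_iff_sum.mpr ⟨fun i j => Complex.normSq_nonneg _, key hW, fun j => ?_⟩
  simpa [Matrix.conjTranspose_apply, Complex.normSq_conj] using key hW' j

/-- The squared Hilbert–Schmidt norm of `D - W D W` for a diagonal matrix `D` and a Hermitian
unitary `W`. -/
theorem trace_sub_conj_sq {n : Type*} [Fintype n] [DecidableEq n] (a : n → ℝ) {W : Matrix n n ℂ}
    (hW : W.IsHermitian) (hW2 : W * W = 1) :
    (((Matrix.diagonal fun i => (a i : ℂ)) - W * (Matrix.diagonal fun i => (a i : ℂ)) * W) *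
      ((Matrix.diagonal fun i => (a i : ℂ)) - W * (Matrix.diagonal fun i => (a i : ℂ)) * W)).trace.re
      = ∑ i, ∑ j, (a i - a j) ^ 2 * Complex.normSq (W i j) := by
  set A : Matrix n n ℂ := Matrix.diagonal fun i => (a i : ℂ) with hA
  have hAH : Aᴴ = A := by
    rw [hA, Matrix.diagonal_conjTranspose]
    congr 1
    ext i
    simp
  -- `A - WAW = [A, W]W`, and the commutator has entries `(aᵢ - aⱼ)Wᵢⱼ`.
  have e : (A - W * A * W) * (A - W * A * W) = (A * W - W * A) * (A * W - W * A)ᴴ := by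
    have e1 : A * W - W * A = (A - W * A * W) * W := by
      rw [sub_mul, mul_assoc (W * A), hW2, mul_one]
    have e2 : (A * W - W * A)ᴴ = W * (A - W * A * W) := by
      rw [Matrix.conjTranspose_sub, Matrix.conjTranspose_mul, Matrix.conjTranspose_mul, hAH, hW.eq,
        mul_sub, ← mul_assoc, ← mul_assoc, hW2, one_mul]
    rw [e2, e1, mul_assoc _ W, ← mul_assoc W W, hW2, one_mul]
  rw [e, Matrix.trace, Complex.re_sum]
  refine Finset.sum_congr rfl fun i _ => ?_
  rw [Matrix.diag_apply, Matrix.mul_apply, Complex.re_sum]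
  refine Finset.sum_congr rfl fun j _ => ?_
  rw [Matrix.conjTranspose_apply, ← starRingEnd_apply, Complex.mul_conj, Complex.ofReal_re,
    Matrix.sub_apply, hA, Matrix.diagonal_mul, Matrix.mul_diagonal, mul_comm (W i j), ← sub_mul,
    ← Complex.ofReal_sub, Complex.normSq_mul, Complex.normSq_ofReal, sq]

theorem trace_diagonal_mul_le_two {a : Fin 4 → ℝ}
    (h₁ : 2 * ((a 0 - a 1) ^ 2 + (a 2 - a 3) ^ 2) ≤ 1)
    (h₂ : 2 * ((a 0 - a 2) ^ 2 + (a 1 - a 3) ^ 2) ≤ 1)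
    (h₃ : 2 * ((a 0 - a 3) ^ 2 + (a 1 - a 2) ^ 2) ≤ 1)
    {W B : Matrix (Fin 4) (Fin 4) ℂ} (hW : W.IsHermitian) (hW2 : W * W = 1)
    (hB : B.IsHermitian) (hWB : W * B * W = -B) (hB2 : (B * B).trace.re = 16) :
    |((Matrix.diagonal fun i => (a i : ℂ)) * B).trace.re| ≤ 2 := by
  have hD := trace_sub_conj_sq a hW hW2
  have hle : ∑ i, ∑ j, (a i - a j) ^ 2 * Complex.normSq (W i j) ≤ 1 :=
    sum_sub_sq_mul_le h₁ h₂ h₃ (normSq_mem_doublyStochastic (by rw [hW.eq, hW2]))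
  rw [← hD] at hle
  have hAH : (Matrix.diagonal fun i => (a i : ℂ)).IsHermitian := by
    rw [Matrix.IsHermitian, Matrix.diagonal_conjTranspose]
    congr 1
    ext i
    simp
  set A : Matrix (Fin 4) (Fin 4) ℂ := Matrix.diagonal fun i => (a i : ℂ)
  set D := A - W * A * W with hDdef
  have hDH : D.IsHermitian := by
    rw [Matrix.IsHermitian, hDdef, Matrix.conjTranspose_sub, Matrix.conjTranspose_mul,
      Matrix.conjTranspose_mul, hAH.eq, hW.eq, mul_assoc]
  have hDB : (D * B).trace = 2 * (A * B).trace := by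
    have : (W * A * W * B).trace = -(A * B).trace := by
      rw [mul_assoc, mul_assoc, Matrix.trace_mul_comm, mul_assoc, mul_assoc, ← mul_assoc W, hWB,
        mul_neg, Matrix.trace_neg]
    rw [hDdef, sub_mul, Matrix.trace_sub, this]
    ring
  -- Cauchy–Schwarz from `Tr (4D - X)² ≥ 0`; the weight `4` matches `‖X‖ = 4` against `‖D‖ ≤ 1`.
  have key (X : Matrix (Fin 4) (Fin 4) ℂ) (hX : X.IsHermitian) (hX2 : (X * X).trace.re = 16) :
      (D * X).trace.re ≤ 4 := by
    have hY : ((4 : ℂ) • D - X).IsHermitian := by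
      rw [Matrix.IsHermitian, Matrix.conjTranspose_sub, Matrix.conjTranspose_smul, hDH.eq, hX.eq]
      simp
    have h := trace_mul_self_nonneg hY
    have e : (((4 : ℂ) • D - X) * ((4 : ℂ) • D - X)).trace =
        16 * (D * D).trace - 8 * (D * X).trace + (X * X).trace := by
      simp only [sub_mul, mul_sub, smul_mul_assoc, mul_smul_comm, Matrix.trace_sub,
        Matrix.trace_smul, smul_eq_mul, Matrix.trace_mul_comm X D]
      ring
    rw [e] at h
    simp only [Complex.add_re, Complex.sub_re, Complex.mul_re, Complex.re_ofNat,
      Complex.im_ofNat, zero_mul, sub_zero, hX2] at h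
    linarith
  have k1 := key B hB hB2
  have k2 := key (-B) hB.neg (by rw [neg_mul_neg, hB2])
  rw [mul_neg, Matrix.trace_neg, Complex.neg_re] at k2
  rw [hDB, Complex.mul_re, Complex.re_ofNat, Complex.im_ofNat, zero_mul, sub_zero] at k1 k2
  exact abs_le.mpr ⟨by linarith, by linarith⟩

/-- A state whose eigenvalues `a` satisfy the pairing inequalities is Bell-CHSH local. -/
theorem IsState.isLocal {a : Fin 4 → ℝ}
    (h₁ : 2 * ((a 0 - a 1) ^ 2 + (a 2 - a 3) ^ 2) ≤ 1)
    (h₂ : 2 * ((a 0 - a 2) ^ 2 + (a 1 - a 3) ^ 2) ≤ 1)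
    (h₃ : 2 * ((a 0 - a 3) ^ 2 + (a 1 - a 2) ^ 2) ≤ 1)
    {V : Matrix Idx (Fin 4) ℂ} (hV : Vᴴ * V = 1) {ρ : Op} (hρ : IsState ρ)
    (hρV : ρ = V * (Matrix.diagonal fun i => (a i : ℂ)) * Vᴴ) : IsLocal ρ := by
  intro A₀ A₁ B₀ B₁ hA₀ hA₁ hB₀ hB₁
  have hB := chshOperator_isHermitian hA₀.isHermitian hA₁.isHermitian hB₀.isHermitian
    hB₁.isHermitian
  have hBB := chshOperator_mul_self hA₀.sq_eq_one hA₁.sq_eq_one hB₀.sq_eq_one hB₁.sq_eq_one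
  by_cases hcomm : A₀ * A₁ - A₁ * A₀ = 0
  · refine hρ.abs_expectation_le_two hB ?_
    rw [hBB, hcomm, Matrix.zero_kronecker, sub_zero]
  obtain ⟨N, hN, hN₀, hN₁⟩ := exists_anticommuting hA₀ hA₁ hcomm
  have hVV : V * Vᴴ = 1 :=
    (Matrix.mul_eq_one_comm_of_card_eq _ _ _ (by simp)).mp hV
  have hW : (N ⊗ₖ (1 : Matrix (Fin 2) (Fin 2) ℂ))ᴴ = N ⊗ₖ 1 := by
    rw [Matrix.conjTranspose_kronecker, hN.isHermitian.eq, Matrix.conjTranspose_one]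
  have hW2 : (N ⊗ₖ (1 : Matrix (Fin 2) (Fin 2) ℂ)) * (N ⊗ₖ 1) = 1 := by
    rw [← Matrix.mul_kronecker_mul, hN.sq_eq_one, one_mul, Matrix.one_kronecker_one]
  have hWB : (N ⊗ₖ (1 : Matrix (Fin 2) (Fin 2) ℂ)) * chshOperator A₀ A₁ B₀ B₁ * (N ⊗ₖ 1) =
      -chshOperator A₀ A₁ B₀ B₁ := by
    have h (X Y : Matrix (Fin 2) (Fin 2) ℂ) : (-X) ⊗ₖ Y = -(X ⊗ₖ Y) := by
      ext; simp [Matrix.kroneckerMap_apply]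
    rw [chshOperator, mul_add, add_mul]
    simp only [← Matrix.mul_kronecker_mul, one_mul, mul_one, hN₀, hN₁, neg_mul, mul_assoc,
      hN.sq_eq_one, h, neg_add]
  have htr : (chshOperator A₀ A₁ B₀ B₁ * chshOperator A₀ A₁ B₀ B₁).trace.re = 16 := by
    rw [hBB, Matrix.trace_sub, Matrix.trace_kronecker, Matrix.trace_sub (A₀ * A₁),
      Matrix.trace_mul_comm A₀ A₁, sub_self, zero_mul, sub_zero, Matrix.trace_smul,
      Matrix.trace_one]
    norm_num [Idx]
  generalize chshOperator A₀ A₁ B₀ B₁ = B at *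
  generalize N ⊗ₖ (1 : Matrix (Fin 2) (Fin 2) ℂ) = W at *
  have conj_mul (X Y : Op) : Vᴴ * X * V * (Vᴴ * Y * V) = Vᴴ * (X * Y) * V := by
    calc Vᴴ * X * V * (Vᴴ * Y * V) = Vᴴ * X * (V * Vᴴ) * Y * V := by simp only [Matrix.mul_assoc]
      _ = Vᴴ * (X * Y) * V := by rw [hVV, Matrix.mul_one, Matrix.mul_assoc Vᴴ]
  have trace_conj (X : Op) : (Vᴴ * X * V).trace = X.trace := by
    rw [Matrix.trace_mul_cycle, hVV, Matrix.one_mul]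
  have herm {X : Op} (hX : Xᴴ = X) : (Vᴴ * X * V).IsHermitian := by
    rw [Matrix.IsHermitian, Matrix.conjTranspose_mul, Matrix.conjTranspose_mul, hX,
      Matrix.conjTranspose_conjTranspose, Matrix.mul_assoc]
  have hmain := trace_diagonal_mul_le_two h₁ h₂ h₃ (herm hW)
    (by rw [conj_mul, hW2, Matrix.mul_one, hV]) (herm hB.eq)
    (by rw [conj_mul, conj_mul, hWB, Matrix.mul_neg, Matrix.neg_mul])
    (by rw [conj_mul, trace_conj, htr])
  rwa [← Matrix.mul_assoc, Matrix.trace_mul_comm, ← Matrix.mul_assoc, ← Matrix.mul_assoc,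
    ← hρV] at hmain


/-! ### The Bell basis and its correlation matrix -/

/-- The matrix whose columns are the Bell states. -/
noncomputable def bellMatrix : Matrix Idx (Fin 4) ℂ := Matrix.of fun p k => bellState k p

theorem inv_sqrt_two_mul_self :
    ((√2 : ℝ) : ℂ)⁻¹ * ((√2 : ℝ) : ℂ)⁻¹ = 1 / 2 := by
  rw [← mul_inv, ← Complex.ofReal_mul, Real.mul_self_sqrt zero_le_two]
  norm_num

theorem bellMatrix_conjTranspose_mul_self : bellMatrixᴴ * bellMatrix = 1 := by
  have h := inv_sqrt_two_mul_self
  ext i j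
  fin_cases i <;> fin_cases j <;>
    simp [Matrix.mul_apply, Fintype.sum_prod_type, Fin.sum_univ_two, bellMatrix, bellState, ket,
      Pi.single_apply, -Complex.ofReal_ofNat, h] <;> norm_num

theorem sum_bellState_eq (a : Fin 4 → ℝ) :
    ∑ k, (a k : ℂ) • Matrix.vecMulVec (bellState k) (star (bellState k)) =
      bellMatrix * (Matrix.diagonal fun i => (a i : ℂ)) * bellMatrixᴴ := by
  ext p q
  rw [Matrix.sum_apply, Matrix.mul_apply]
  refine Finset.sum_congr rfl fun k _ => ?_
  rw [Matrix.mul_diagonal]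
  simp only [bellMatrix, Matrix.smul_apply, Matrix.vecMulVec_apply, Matrix.conjTranspose_apply,
    Matrix.of_apply, Pi.star_apply, smul_eq_mul]
  ring

theorem correlationMatrix_bellDiagonal (a : Fin 4 → ℝ) :
    correlationMatrix (∑ k, (a k : ℂ) • Matrix.vecMulVec (bellState k) (star (bellState k))) =
      Matrix.diagonal
        ![a 0 - a 1 + a 2 - a 3, -a 0 + a 1 + a 2 - a 3, a 0 + a 1 - a 2 - a 3] := by
  have hproj (k : Fin 4) (O : Op) :
      expectation (Matrix.vecMulVec (bellState k) (star (bellState k))) O =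
        (star (bellState k) ⬝ᵥ O *ᵥ bellState k).re := by
    rw [expectation, Matrix.vecMulVec_mul, Matrix.trace_vecMulVec, Matrix.dotProduct_mulVec,
      dotProduct_comm]
  have hsum (O : Op) :
      expectation (∑ k, (a k : ℂ) • Matrix.vecMulVec (bellState k) (star (bellState k))) O =
        ∑ k, a k * (star (bellState k) ⬝ᵥ O *ᵥ bellState k).re := by
    simp only [← hproj]
    simp [expectation, Finset.sum_mul, Matrix.trace_sum, Matrix.trace_smul]
  have h := inv_sqrt_two_mul_self
  ext i j
  rw [correlationMatrix, Matrix.of_apply, hsum, Fin.sum_univ_four]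
  fin_cases i <;> fin_cases j <;>
    simp [pauli, bellState, ket, dotProduct, Matrix.mulVec, Fintype.sum_prod_type,
      Fin.sum_univ_two, Pi.single_apply, Matrix.kroneckerMap_apply,
      -Complex.ofReal_ofNat, h, -mul_eq_mul_left_iff] <;> ring

/-! ### Necessity: optimal Pauli measurements -/

theorem pauli_isDichotomic_combination {i j : Fin 3} (hij : i ≠ j) {c s : ℝ}
    (h : c ^ 2 + s ^ 2 = 1) : IsDichotomic ((c : ℂ) • pauli i + (s : ℂ) • pauli j) := by
  have hc : (c : ℂ) ^ 2 + (s : ℂ) ^ 2 = 1 := by exact_mod_cast h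
  constructor
  · ext p q
    fin_cases i <;> fin_cases j <;> fin_cases p <;> fin_cases q <;>
      simp [pauli, Matrix.conjTranspose_apply]
  · fin_cases i <;> fin_cases j <;> first | exact absurd rfl hij | skip
    all_goals
      ext p q
      fin_cases p <;> fin_cases q <;> simp [pauli, Matrix.mul_apply, Fin.sum_univ_two] <;>
        ring_nf <;> (try simp only [Complex.I_sq]) <;> linear_combination hc

theorem IsLocal.sq_add_sq_le_one {σ : Op} (hσ : IsLocal σ) {i j : Fin 3} (hij : i ≠ j) :
    correlationMatrix σ i i ^ 2 + correlationMatrix σ j j ^ 2 ≤ 1 := by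
  set x := correlationMatrix σ i i with hx
  set y := correlationMatrix σ j j with hy
  by_contra! hlt
  set r := √(x ^ 2 + y ^ 2) with hr
  have hr2 : r ^ 2 = x ^ 2 + y ^ 2 := Real.sq_sqrt (by positivity)
  have hr1 : 1 < r := by nlinarith [Real.sqrt_nonneg (x ^ 2 + y ^ 2)]
  have hr0 : r ≠ 0 := by linarith
  have hcs : (x / r) ^ 2 + (y / r) ^ 2 = 1 := by
    rw [div_pow, div_pow, ← add_div, hr2, div_self (by positivity)]
  have hi : IsDichotomic (pauli i) := by
    simpa using pauli_isDichotomic_combination hij (c := 1) (s := 0) (by norm_num)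
  have hj : IsDichotomic (pauli j) := by
    simpa using pauli_isDichotomic_combination hij (c := 0) (s := 1) (by norm_num)
  -- `B₀ ± B₁` are then `2(x/r)sᵢ` and `2(y/r)sⱼ`, with `(x, y)/r` the unit vector maximising the
  -- value, namely `2r`.
  have h := hσ _ _ _ _ hi hj (pauli_isDichotomic_combination hij hcs)
    (pauli_isDichotomic_combination hij (c := x / r) (s := -(y / r)) (by rw [neg_sq, hcs]))
  have e : expectation σ (chshOperator (pauli i) (pauli j)
      (((x / r : ℝ) : ℂ) • pauli i + ((y / r : ℝ) : ℂ) • pauli j)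
      (((x / r : ℝ) : ℂ) • pauli i + ((-(y / r) : ℝ) : ℂ) • pauli j)) =
      2 * (x / r) * x + 2 * (y / r) * y := by
    have e1 : chshOperator (pauli i) (pauli j)
        (((x / r : ℝ) : ℂ) • pauli i + ((y / r : ℝ) : ℂ) • pauli j)
        (((x / r : ℝ) : ℂ) • pauli i + ((-(y / r) : ℝ) : ℂ) • pauli j) =
        ((2 * (x / r) : ℝ) : ℂ) • (pauli i ⊗ₖ pauli i) +
          ((2 * (y / r) : ℝ) : ℂ) • (pauli j ⊗ₖ pauli j) := by
      rw [chshOperator, ← Matrix.kronecker_smul, ← Matrix.kronecker_smul]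
      congr 2 <;> push_cast <;> module
    rw [e1, expectation, mul_add, mul_smul_comm, mul_smul_comm, Matrix.trace_add,
      Matrix.trace_smul, Matrix.trace_smul, smul_eq_mul, smul_eq_mul, Complex.add_re,
      Complex.re_ofReal_mul, Complex.re_ofReal_mul]
    rfl
  have e2 : 2 * (x / r) * x + 2 * (y / r) * y = 2 * r := by
    field_simp
    linarith
  rw [e, e2] at h
  linarith [le_abs_self (2 * r)]

theorem isLocal_of_isAbsolutelyLocal {σ : Op} (h : IsAbsolutelyLocal σ) : IsLocal σ := by
  simpa using h 1 (one_mem _)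

end BellCHSH

theorem theorem2 (σ : BellCHSH.Op) (hσ : BellCHSH.IsState σ)
    (hBell : BellCHSH.IsBellDiagonal σ) (t : Matrix (Fin 3) (Fin 3) ℝ)
    (ht : t = BellCHSH.correlationMatrix σ) :
    t.IsDiag ∧
    (BellCHSH.IsAbsolutelyLocal σ ↔
      max (max (t 0 0 ^ 2 + t 1 1 ^ 2) (t 0 0 ^ 2 + t 2 2 ^ 2)) (t 1 1 ^ 2 + t 2 2 ^ 2) ≤ 1) ∧
    (BellCHSH.IsAbsolutelyLocal σ ↔ BellCHSH.IsLocal σ) := by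
  obtain ⟨a, ha⟩ := hBell
  have hdiag := BellCHSH.correlationMatrix_bellDiagonal a
  rw [← ha, ← ht] at hdiag
  have hnec (h : BellCHSH.IsLocal σ) :
      max (max (t 0 0 ^ 2 + t 1 1 ^ 2) (t 0 0 ^ 2 + t 2 2 ^ 2)) (t 1 1 ^ 2 + t 2 2 ^ 2) ≤ 1 := by
    rw [ht]
    exact max_le (max_le (h.sq_add_sq_le_one (by decide)) (h.sq_add_sq_le_one (by decide)))
      (h.sq_add_sq_le_one (by decide))
  have hsuff (h : max (max (t 0 0 ^ 2 + t 1 1 ^ 2) (t 0 0 ^ 2 + t 2 2 ^ 2))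
      (t 1 1 ^ 2 + t 2 2 ^ 2) ≤ 1) : BellCHSH.IsAbsolutelyLocal σ := by
    intro U hU
    have h0 : t 0 0 = a 0 - a 1 + a 2 - a 3 := by simp [hdiag]
    have h1 : t 1 1 = -a 0 + a 1 + a 2 - a 3 := by simp [hdiag]
    have h2 : t 2 2 = a 0 + a 1 - a 2 - a 3 := by simp [hdiag]
    obtain ⟨⟨h01, h02⟩, h12⟩ : (_ ∧ _) ∧ _ := by simpa only [max_le_iff] using h
    rw [h0, h1] at h01
    rw [h0, h2] at h02
    rw [h1, h2] at h12
    have hUU : Uᴴ * U = 1 := Matrix.mem_unitaryGroup_iff'.mp hU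
    -- By `(u + v)² + (u - v)² = 2(u² + v²)`, each bound on two correlations is exactly one pairing
    -- inequality.
    refine (hσ.unitary_conj hU).isLocal (a := a) (V := U * BellCHSH.bellMatrix)
      (by linarith) (by linarith) (by linarith) ?_ ?_
    · rw [Matrix.conjTranspose_mul, Matrix.mul_assoc, ← Matrix.mul_assoc Uᴴ, hUU, Matrix.one_mul,
        BellCHSH.bellMatrix_conjTranspose_mul_self]
    · rw [ha, BellCHSH.sum_bellState_eq, Matrix.conjTranspose_mul]
      simp only [Matrix.mul_assoc]
  refine ⟨hdiag ▸ Matrix.isDiag_diagonal _, ⟨fun h => hnec ?_, hsuff⟩, ?_, fun h => hsuff (hnec h)⟩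
  · exact BellCHSH.isLocal_of_isAbsolutelyLocal h
  · exact BellCHSH.isLocal_of_isAbsolutelyLocal
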